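/- Let $(a,b)\subset\mathbb{R}$ be a finite interval, $1\le p\le\infty$, $n\in\mathbb{N}\cup\{0\}$ and $m,r,l\in\mathbb{N}$. Let $W_p^0=L_p([a,b];\mathbb{C})$ and, for $s\ge1$, let $W_p^{s}=\{y\in C^{s-1}([a,b];\mathbb{C}) : y^{(s-1)}\in AC[a,b],\ y^{(s)}\in L_p[a,b]\}$, with the norm $\sum_{k=0}^{s}\|y^{(k)}\|_{p}$; spaces of vector-valued and matrix-valued functions are defined entrywise, with the sum of the norms of the entries. Consider the boundary-value problem $$(Ly)(t):=y^{(r)}(t)+\sum_{j=1}^{r}A_{r-j}(t)y^{(r-j)}(t)=f(t),\quad t\in(a,b),\qquad By=c,$$ with $A_{r-j}\in(W_p^n)^{m\times m}$ and a bounded linear operator $B\colon(W_p^{n+r})^m\to\mathbb{C}^l$, and a sequence of problems of the same form (with the same $a,b,p,n,m,r,l$), $$L(k)y:=y^{(r)}+\sum_{j=1}^{r}A_{r-j}(\cdot,k)y^{(r-j)}=f,\qquad B(k)y=c,\qquad k\in\mathbb{N}.$$ A solution is a function $y\in(W_p^{n+r})^m$ that satisfies the boundary condition, and the differential equation everywhere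 on $(a,b)$ if $n\ge1$ and almost everywhere on $(a,b)$ if $n=0$. Suppose that the operators $(L(k),B(k))\colon(W_p^{n+r})^m\to(W_p^n)^m\times\mathbb{C}^l$ converge strongly to $(L,B)$ as $k\to\infty$, i.e. for every $y\in(W_p^{n+r})^m$ we have $L(k)y\to Ly$ in $(W_p^n)^m$ and $B(k)y\to By$ in $\mathbb{C}^l$. If the problem $Ly=f$, $By=c$ has a solution for every $f\in(W_p^n)^m$ and every $c\in\mathbb{C}^l$, then there is $k_0$ such that for every $k\ge k_0$ the problem $L(k)y=f$, $B(k)y=c$ has a solution for every $f\in(W_p^n)^m$ and every $c\in\mathbb{C}^l$. -/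

import Mathlib

open Set Filter Topology MeasureTheory
open scoped ENNReal NNReal

namespace GenericBVP

/-- `y ∈ W_p^s([a,b]; ℂ)`.  A function on `[a,b]` is represented by a function on `ℝ` whose values
outside `[a,b]` are irrelevant; all derivatives are derivatives within `[a,b]` (one-sided at the end
points).  For `s = 0` this is `L_p`, and for `s ≥ 1` it says that `y ∈ C^{s-1}[a,b]`, that
`y^{(s-1)}` is absolutely continuous on `[a,b]` and that `y^{(s)} ∈ L_p[a,b]`. -/
def MemSobolev (a b : ℝ) (p : ℝ≥0∞) : ℕ → (ℝ → ℂ) → Prop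
  | 0, y => MemLp y p (volume.restrict (Icc a b))
  | s + 1, y =>
      ContDiffOn ℝ s y (Icc a b) ∧
      AbsolutelyContinuousOnInterval (iteratedDerivWithin s y (Icc a b)) a b ∧
      MemLp (iteratedDerivWithin (s + 1) y (Icc a b)) p (volume.restrict (Icc a b))

/-- The norm `‖y‖_{s,p} = ∑_{k=0}^{s} ‖y^{(k)}‖_p`. -/
noncomputable def sobolevNorm (a b : ℝ) (p : ℝ≥0∞) (s : ℕ) (y : ℝ → ℂ) : ℝ≥0∞ :=
  ∑ k ∈ Finset.range (s + 1),
    eLpNorm (iteratedDerivWithin k y (Icc a b)) p (volume.restrict (Icc a b))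

theorem ae_differentiableWithinAt_of_ac {a b : ℝ} (hab : a < b) {g : ℝ → ℂ}
    (hg : AbsolutelyContinuousOnInterval g a b) :
    ∀ᵐ t ∂(volume.restrict (Icc a b)), DifferentiableWithinAt ℝ g (Icc a b) t := by
  have h := hg.boundedVariationOn.ae_differentiableAt_of_mem_uIcc
  rw [uIcc_of_le hab.le] at h
  rw [ae_restrict_iff' measurableSet_Icc]
  filter_upwards [h] with t ht hmem
  exact (ht hmem).differentiableWithinAt

theorem ac_congr {a b : ℝ} (hab : a < b) {g h : ℝ → ℂ}
    (hg : AbsolutelyContinuousOnInterval g a b) (hgh : EqOn g h (Icc a b)) :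
    AbsolutelyContinuousOnInterval h a b := by
  rw [absolutelyContinuousOnInterval_iff] at hg ⊢
  intro ε hε
  obtain ⟨δ, hδ, H⟩ := hg ε hε
  refine ⟨δ, hδ, fun E hE hlen => ?_⟩
  have := H E hE hlen
  have hE' := hE.1
  rw [uIcc_of_le hab.le] at hE'
  rwa [Finset.sum_congr rfl (fun i hi => by rw [hgh (hE' i hi).1, hgh (hE' i hi).2])] at this

theorem MemSobolev.add {a b : ℝ} (hab : a < b) {p : ℝ≥0∞} {s : ℕ} {y z : ℝ → ℂ}
    (hy : MemSobolev a b p s y) (hz : MemSobolev a b p s z) : MemSobolev a b p s (y + z) := by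
  cases s with
  | zero => exact MemLp.add hy hz
  | succ s =>
    obtain ⟨hy1, hy2, hy3⟩ := hy
    obtain ⟨hz1, hz2, hz3⟩ := hz
    have hu := uniqueDiffOn_Icc hab
    have hE : EqOn (iteratedDerivWithin s y (Icc a b) + iteratedDerivWithin s z (Icc a b))
        (iteratedDerivWithin s (y + z) (Icc a b)) (Icc a b) := fun t ht =>
      (iteratedDerivWithin_add ht hu (hy1 t ht) (hz1 t ht)).symm
    refine ⟨hy1.add hz1, ac_congr hab (hy2.add hz2) hE, ?_⟩
    refine (memLp_congr_ae ?_).1 (hy3.add hz3)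
    filter_upwards [ae_differentiableWithinAt_of_ac hab hy2,
      ae_differentiableWithinAt_of_ac hab hz2, ae_restrict_mem measurableSet_Icc] with t h1 h2 ht
    rw [Pi.add_apply, iteratedDerivWithin_succ, iteratedDerivWithin_succ,
      iteratedDerivWithin_succ, ← derivWithin_add h1 h2]
    exact derivWithin_congr hE (hE ht)

theorem MemSobolev.smul {a b : ℝ} {p : ℝ≥0∞} {s : ℕ} {y : ℝ → ℂ} (c : ℂ)
    (hy : MemSobolev a b p s y) : MemSobolev a b p s (c • y) := by
  have hD : ∀ k : ℕ, iteratedDerivWithin k (c • y) (Icc a b) =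
      c • iteratedDerivWithin k y (Icc a b) := fun k => by
    funext t
    exact iteratedDerivWithin_const_smul_field c y
  cases s with
  | zero => exact MemLp.const_smul hy c
  | succ s =>
    obtain ⟨hy1, hy2, hy3⟩ := hy
    refine ⟨hy1.const_smul c, ?_, ?_⟩
    · rw [hD]
      exact hy2.const_smul c
    · rw [hD]
      exact hy3.const_smul c

theorem MemSobolev.zero (a b : ℝ) (p : ℝ≥0∞) (s : ℕ) : MemSobolev a b p s 0 := by
  have hD : ∀ k : ℕ, iteratedDerivWithin k (0 : ℝ → ℂ) (Icc a b) = 0 := fun k => by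
    have := funext fun t => iteratedDerivWithin_const_smul_field (n := k) (s := Icc a b)
      (x := t) (0 : ℂ) (0 : ℝ → ℂ)
    rw [zero_smul] at this
    rw [this]
    simp only [zero_smul]
    rfl
  cases s with
  | zero => exact MemLp.zero
  | succ s =>
    refine ⟨contDiffOn_const, ?_, ?_⟩
    · rw [hD, absolutelyContinuousOnInterval_iff]
      exact fun ε hε => ⟨1, one_pos, fun E _ _ => by simpa using hε⟩
    · rw [hD]
      exact MemLp.zero

/-- The complex vector space `W_p^s([a,b]; ℂ)`. -/
def sobolev {a b : ℝ} (hab : a < b) (p : ℝ≥0∞) (s : ℕ) : Submodule ℂ (ℝ → ℂ) where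
  carrier := {y | MemSobolev a b p s y}
  add_mem' hy hz := MemSobolev.add hab hy hz
  zero_mem' := MemSobolev.zero a b p s
  smul_mem' c _ hy := MemSobolev.smul c hy

/-- The data of a boundary-value problem: coefficients `A j ∈ (W_p^n)^{m×m}`, where `A j` multiplies
`y^{(j)}` for `0 ≤ j < r`, and a bounded linear operator `B : (W_p^{n+r})^m → ℂ^l`.  Boundedness
with respect to the Sobolev norm makes `B y` depend only on the restriction of `y` to `[a,b]`. -/
structure BoundaryProblem {a b : ℝ} (hab : a < b) (p : ℝ≥0∞) (n m r l : ℕ) where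
  A : Fin r → ℝ → Matrix (Fin m) (Fin m) ℂ
  A_mem : ∀ (j : Fin r) (i i' : Fin m), MemSobolev a b p n (fun t => A j t i i')
  B : (Fin m → sobolev hab p (n + r)) →ₗ[ℂ] (Fin l → ℂ)
  B_bounded : ∃ C : ℝ≥0, ∀ y : Fin m → sobolev hab p (n + r),
    ‖B y‖ₑ ≤ C * ∑ i, sobolevNorm a b p (n + r) (y i : ℝ → ℂ)

namespace BoundaryProblem

variable {a b : ℝ} {hab : a < b} {p : ℝ≥0∞} {n m r l : ℕ}

/-- `(L y)(t) = y^{(r)}(t) + ∑_{j=0}^{r-1} A_j(t) y^{(j)}(t)`. -/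
noncomputable def L (P : BoundaryProblem hab p n m r l) (y : Fin m → sobolev hab p (n + r))
    (t : ℝ) : Fin m → ℂ :=
  (fun i => iteratedDerivWithin r (y i : ℝ → ℂ) (Icc a b) t) +
    ∑ j : Fin r, (P.A j t).mulVec
      (fun i => iteratedDerivWithin (j : ℕ) (y i : ℝ → ℂ) (Icc a b) t)

/-- `y ∈ (W_p^{n+r})^m` solves `L y = f`, `B y = c`: the differential equation holds everywhere on
`(a,b)` if `n ≥ 1`, and almost everywhere if `n = 0`. -/
def IsSolution (P : BoundaryProblem hab p n m r l) (f : ℝ → Fin m → ℂ) (c : Fin l → ℂ)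
    (y : Fin m → sobolev hab p (n + r)) : Prop :=
  (n = 0 → ∀ᵐ t ∂(volume.restrict (Ioo a b)), P.L y t = f t) ∧
  (1 ≤ n → ∀ t ∈ Ioo a b, P.L y t = f t) ∧
  P.B y = c

/-- The problem has a solution for all right-hand sides `f ∈ (W_p^n)^m` and `c ∈ ℂ^l`. -/
def Solvable (P : BoundaryProblem hab p n m r l) : Prop :=
  ∀ (f : ℝ → Fin m → ℂ), (∀ i, MemSobolev a b p n (fun t => f t i)) →
    ∀ c : Fin l → ℂ, ∃ y : Fin m → sobolev hab p (n + r), P.IsSolution f c y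

/-- Strong convergence of the operators `(L(k),B(k)) : (W_p^{n+r})^m → (W_p^n)^m × ℂ^l`
to `(L,B)`: for every `y`, `L(k)y → Ly` in `(W_p^n)^m` and `B(k)y → By` in `ℂ^l`. -/
def StronglyConverges (P : ℕ → BoundaryProblem hab p n m r l)
    (Q : BoundaryProblem hab p n m r l) : Prop :=
  ∀ y : Fin m → sobolev hab p (n + r),
    Tendsto (fun k => ∑ i, sobolevNorm a b p n (fun t => (P k).L y t i - Q.L y t i))
      atTop (𝓝 0) ∧
    Tendsto (fun k => (P k).B y) atTop (𝓝 (Q.B y))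

end BoundaryProblem

end GenericBVP

/-!
Modulo null functions, the problem is solvable for all right-hand sides exactly when the bounded
operator `(L, B) : (W_p^{n+r})^m → (W_p^n)^m × ℂ^l` is surjective
(`GenericBVP.BoundaryProblem.solvable_iff_surjective`), so the claim is that surjectivity survives
a small perturbation. Strong convergence alone does not give this in general; two special features
of the problem do.

* Strong convergence of the `L(k)` is already convergence in norm. Applying `L(k) - L` to the vector
  functions `t^j e_i` shows that the coefficients converge in `W_p^n`
  (`StronglyConverges.tendsto_coeff`). Since `W_p^n · W_p^{n+1} ⊆ W_p^n` with a norm estimate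
  (`exists_sobolevNorm_mul_le`) and `y^{(j)} ∈ W_p^{n+1}` for `j < r`, the operators then converge in
  norm (`StronglyConverges.tendsto_operator`).
* The operators `B(k)` take values in a finite-dimensional space. By the open mapping theorem and
  norm convergence, `L(k)` is surjective for large `k`, with preimages bounded uniformly in `k`.
  Choose `y_1, …, y_l ∈ ker L` with `B y_i = e_i`. Small corrections move them into `ker L(k)`, and
  as the `B(k)` are uniformly bounded by the Banach-Steinhaus theorem, the images under `B(k)` of the
  corrected functions converge to the `e_i`; for large `k` they form a basis of `ℂ^l`. Hence `B(k)`
  maps `ker L(k)` onto `ℂ^l`, and `(L(k), B(k))` is surjective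
  (`ContinuousLinearMap.eventually_surjective_prod`).

Both steps need the spaces `W_p^s` to be complete. This follows from the completeness of `L_p` by
induction on `s`, because a function in `W_p^{s+1}` is determined by its value at `a` and its
derivative in `W_p^s`, through the fundamental theorem of calculus for absolutely continuous
functions.
-/

/-! ### Stability of surjectivity -/

section Stability

variable {𝕜 X Y : Type*} [NontriviallyNormedField 𝕜]

/-- Surjectivity of a bounded operator between Banach spaces is stable under perturbations that are
small in norm, and the preimages under the perturbed operators obey a uniform bound. -/
theorem ContinuousLinearMap.eventually_exists_preimage_norm_le
    [NormedAddCommGroup X] [NormedSpace 𝕜 X] [CompleteSpace X]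
    [NormedAddCommGroup Y] [NormedSpace 𝕜 Y] [CompleteSpace Y]
    {T : ℕ → X →L[𝕜] Y} {T₀ : X →L[𝕜] Y} (hT : Tendsto T atTop (𝓝 T₀))
    (hsurj : Function.Surjective T₀) :
    ∃ D : ℝ, ∀ᶠ k in atTop, ∀ f : Y, ∃ x : X, T k x = f ∧ ‖x‖ ≤ D * ‖f‖ := by
  set N := T₀.nonlinearRightInverseOfSurjective (LinearMap.range_eq_top.2 hsurj) with hN
  have hpos : 0 < N.nnnorm := T₀.nonlinearRightInverseOfSurjective_nnnorm_pos _
  -- Perturbations of norm at most half the inverse bound of `T₀` keep surjectivity.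
  set c : ℝ≥0 := N.nnnorm⁻¹ / 2 with hc
  have hc0 : 0 < c := by positivity
  have hcN : ((N.nnnorm : ℝ)⁻¹ - c) = c := by
    rw [hc]; push_cast; ring
  refine ⟨(c : ℝ)⁻¹, ?_⟩
  filter_upwards [Metric.tendsto_nhds.1 hT c (by exact_mod_cast hc0)] with k hk f
  have happ : ApproximatesLinearOn (T k) T₀ univ c := by
    intro x _ y _
    have := (T k - T₀).le_opNorm (x - y)
    rw [← dist_eq_norm] at this
    simp only [sub_apply, map_sub] at this ⊢
    refine le_trans (le_of_eq_of_le ?_ this) (by gcongr)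
    congr 1; abel
  have hs := happ.surjOn_closedBall_of_nonlinearRightInverse N
    (ε := (c : ℝ)⁻¹ * ‖f‖) (b := 0) (by positivity) (subset_univ _)
  have hf : f ∈ Metric.closedBall (T k 0) (((N.nnnorm : ℝ)⁻¹ - c) * ((c : ℝ)⁻¹ * ‖f‖)) := by
    rw [hcN, map_zero, mem_closedBall_zero_iff, ← mul_assoc, mul_inv_cancel₀ (by positivity),
      one_mul]
  obtain ⟨x, hx, hxf⟩ := hs hf
  exact ⟨x, hxf, by simpa using hx⟩

/-- The Banach space case of `ContinuousLinearMap.eventually_surjective_prod`. -/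
theorem ContinuousLinearMap.eventually_surjective_prod_of_normed {ι : Type*} [Fintype ι]
    [NormedAddCommGroup X] [NormedSpace 𝕜 X] [CompleteSpace X]
    [NormedAddCommGroup Y] [NormedSpace 𝕜 Y] [CompleteSpace Y]
    {T : ℕ → X →L[𝕜] Y} {T₀ : X →L[𝕜] Y} (hT : Tendsto T atTop (𝓝 T₀))
    {B : ℕ → X →L[𝕜] (ι → 𝕜)} {B₀ : X →L[𝕜] (ι → 𝕜)}
    (hB : ∀ x, Tendsto (fun k => B k x) atTop (𝓝 (B₀ x)))
    (hsurj : Function.Surjective fun x => (T₀ x, B₀ x)) :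
    ∀ᶠ k in atTop, Function.Surjective fun x => (T k x, B k x) := by
  classical
  have hsurj₀ : Function.Surjective T₀ := fun f => by
    obtain ⟨x, hx⟩ := hsurj (f, 0)
    exact ⟨x, congrArg Prod.fst hx⟩
  obtain ⟨D, hD⟩ := ContinuousLinearMap.eventually_exists_preimage_norm_le hT hsurj₀
  obtain ⟨M, hM⟩ : ∃ M, ∀ k, ‖B k‖ ≤ M := banach_steinhaus fun x => by
    obtain ⟨C, hC⟩ := (hB x).norm.bddAbove_range
    exact ⟨C, fun k => hC ⟨k, rfl⟩⟩
  have hM0 : 0 ≤ M := (norm_nonneg _).trans (hM 0)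
  -- Elements of `ker T₀` that `B₀` sends to the standard basis.
  have hy : ∀ i : ι, ∃ y, T₀ y = 0 ∧ B₀ y = Pi.single i 1 := fun i => by
    obtain ⟨y, hy⟩ := hsurj (0, Pi.single i 1)
    exact ⟨y, congrArg Prod.fst hy, congrArg Prod.snd hy⟩
  choose y hy₀ hyB using hy
  -- Corrections `z k i` that move `y i` into `ker (T k)`, controlled by `T k (y i) → 0`.
  have hz : ∀ k, ∃ z : ι → X, (∀ f : Y, ∃ x : X, T k x = f ∧ ‖x‖ ≤ D * ‖f‖) →
      ∀ i, T k (z i) = T k (y i) ∧ ‖z i‖ ≤ D * ‖T k (y i)‖ := fun k => by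
    by_cases h : ∀ f : Y, ∃ x : X, T k x = f ∧ ‖x‖ ≤ D * ‖f‖
    · choose z hz using fun i => h (T k (y i))
      exact ⟨z, fun _ => hz⟩
    · exact ⟨0, fun h' => absurd h' h⟩
  choose z hz using hz
  have hBu : ∀ i, Tendsto (fun k => B k (y i - z k i)) atTop (𝓝 (Pi.single i 1)) := fun i => by
    have hTy : Tendsto (fun k => M * (D * ‖T k (y i)‖)) atTop (𝓝 0) := by
      have h1 : Tendsto (fun k => T k (y i)) atTop (𝓝 (T₀ (y i))) :=
        ((ContinuousLinearMap.apply 𝕜 Y (y i)).continuous.tendsto T₀).comp hT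
      rw [hy₀] at h1
      simpa using (h1.norm.const_mul D).const_mul M
    have hBz : Tendsto (fun k => B k (z k i)) atTop (𝓝 0) := by
      refine squeeze_zero_norm' ?_ hTy
      filter_upwards [hD] with k hk
      exact ((B k).le_of_opNorm_le (hM k) _).trans
        (mul_le_mul_of_nonneg_left (hz k hk i).2 hM0)
    simpa [map_sub, hyB] using (hB (y i)).sub hBz
  -- The matrices with columns `B k (y i - z k i)` converge to the identity matrix.
  have hdet : Tendsto (fun k => (Matrix.of fun i' i => B k (y i - z k i) i').det) atTop (𝓝 1) := by
    have h1 : Tendsto (fun k => (Matrix.of fun i' i => B k (y i - z k i) i' : Matrix ι ι 𝕜)) atTop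
        (𝓝 1) := by
      refine tendsto_pi_nhds.2 fun i' => tendsto_pi_nhds.2 fun i => ?_
      have := tendsto_pi_nhds.1 (hBu i) i'
      rwa [show (Pi.single i 1 : ι → 𝕜) i' = (1 : Matrix ι ι 𝕜) i' i by
        rw [Matrix.one_apply, Pi.single_apply]] at this
    have h2 : Continuous fun A : Matrix ι ι 𝕜 => A.det := continuous_id.matrix_det
    have h3 := (h2.tendsto 1).comp h1
    rwa [Matrix.det_one] at h3
  filter_upwards [hD, hdet.eventually_ne one_ne_zero] with k hk hdk
  rintro ⟨f, c⟩
  obtain ⟨x, hx, -⟩ := hk f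
  obtain ⟨v, hv⟩ : ∃ v, (Matrix.of fun i' i => B k (y i - z k i) i').mulVec v = c - B k x :=
    (Matrix.mulVec_surjective_iff_isUnit.2
      ((Matrix.isUnit_iff_isUnit_det _).2 (isUnit_iff_ne_zero.2 hdk))) _
  refine ⟨x + ∑ i, v i • (y i - z k i), Prod.ext ?_ ?_⟩
  · simp [hx, map_sub, (hz k hk _).1]
  · have : B k (∑ i, v i • (y i - z k i)) = c - B k x := by
      rw [← hv]
      ext i'
      simp [-map_sub, Matrix.mulVec, dotProduct, mul_comm]
    simp only [map_add, this]
    abel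

/-- Let `T k → T₀` in norm, and let `B k → B₀` strongly, with finite-dimensional values. If
`(T₀, B₀)` is surjective, then so is `(T k, B k)` for all large `k`. Strong convergence of the
`B k` is enough because the finitely many elements of `ker T₀` that `B₀` sends to a basis move only
little when they are corrected to elements of `ker (T k)`. -/
theorem ContinuousLinearMap.eventually_surjective_prod {ι : Type*} [Fintype ι]
    [SeminormedAddCommGroup X] [NormedSpace 𝕜 X] [CompleteSpace X]
    [NormedAddCommGroup Y] [NormedSpace 𝕜 Y] [CompleteSpace Y]
    {T : ℕ → X →L[𝕜] Y} {T₀ : X →L[𝕜] Y} (hT : Tendsto T atTop (𝓝 T₀))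
    {B : ℕ → X →L[𝕜] (ι → 𝕜)} {B₀ : X →L[𝕜] (ι → 𝕜)}
    (hB : ∀ x, Tendsto (fun k => B k x) atTop (𝓝 (B₀ x)))
    (hsurj : Function.Surjective fun x => (T₀ x, B₀ x)) :
    ∀ᶠ k in atTop, Function.Surjective fun x => (T k x, B k x) := by
  -- A continuous linear section of the quotient map reduces the claim to Banach spaces.
  set σ := SeparationQuotient.outCLM 𝕜 X with hσ
  have hins : ∀ x : X, Inseparable (σ (SeparationQuotient.mk x)) x := fun x =>
    SeparationQuotient.mk_eq_mk.1 (SeparationQuotient.mk_outCLM _ _)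
  have key := ContinuousLinearMap.eventually_surjective_prod_of_normed
    (T := fun k => T k ∘L σ) (T₀ := T₀ ∘L σ) (B := fun k => B k ∘L σ) (B₀ := B₀ ∘L σ)
    ((((ContinuousLinearMap.compL 𝕜 _ X Y).flip σ).continuous.tendsto T₀).comp hT)
    (fun x => hB (σ x)) (fun w => by
      obtain ⟨x, rfl⟩ := hsurj w
      exact ⟨SeparationQuotient.mk x, Prod.ext ((hins x).map T₀.continuous).eq
        ((hins x).map B₀.continuous).eq⟩)
  filter_upwards [key] with k hk w
  obtain ⟨x, hx⟩ := hk w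
  exact ⟨σ x, hx⟩

end Stability

namespace GenericBVP

/-! ### Absolutely continuous complex-valued functions -/

section AbsolutelyContinuous

variable {a b : ℝ} {y g : ℝ → ℂ}

theorem absolutelyContinuousOnInterval_primitive (hab : a < b)
    (hg : IntervalIntegrable g volume a b) :
    AbsolutelyContinuousOnInterval (fun t => ∫ τ in a..t, g τ) a b := by
  have hre : IntervalIntegrable (fun t => (g t).re) volume a b :=
    ⟨hg.1.re, hg.2.re⟩
  have him : IntervalIntegrable (fun t => (g t).im) volume a b :=
    ⟨hg.1.im, hg.2.im⟩
  have hconst : ∀ c : ℂ, AbsolutelyContinuousOnInterval (fun _ : ℝ => c) a b := fun c =>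
    (contDiff_const (n := 1)).contDiffOn.absolutelyContinuousOnInterval
  have h1 := (hre.absolutelyContinuousOnInterval_intervalIntegral left_mem_uIcc).smul (hconst 1)
  have h2 := (him.absolutelyContinuousOnInterval_intervalIntegral left_mem_uIcc).smul
    (hconst Complex.I)
  refine ac_congr hab (h1.add h2) fun t ht => ?_
  have hgt : IntervalIntegrable g volume a t :=
    hg.mono_set (by rw [uIcc_of_le ht.1, uIcc_of_le hab.le]; exact Icc_subset_Icc_right ht.2)
  have e1 : ∫ τ in a..t, (g τ).re = (∫ τ in a..t, g τ).re :=
    Complex.reCLM.intervalIntegral_comp_comm hgt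
  have e2 : ∫ τ in a..t, (g τ).im = (∫ τ in a..t, g τ).im :=
    Complex.imCLM.intervalIntegral_comp_comm hgt
  simp only [Pi.add_apply, Pi.smul_apply', e1, e2, Complex.real_smul, mul_one]
  exact Complex.re_add_im _

theorem ae_hasDerivAt_of_ac (hab : a < b) (hy : AbsolutelyContinuousOnInterval y a b) :
    ∀ᵐ t, t ∈ Icc a b → HasDerivAt y (derivWithin y (Icc a b) t) t := by
  have h := hy.boundedVariationOn.ae_differentiableAt_of_mem_uIcc
  rw [uIcc_of_le hab.le] at h
  filter_upwards [h] with t ht hmem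
  rw [(ht hmem).derivWithin (uniqueDiffOn_Icc hab t hmem)]
  exact (ht hmem).hasDerivAt

theorem ae_hasDerivAt_primitive (hab : a < b) (hg : IntervalIntegrable g volume a b) :
    ∀ᵐ t, t ∈ Icc a b → HasDerivAt (fun t => ∫ τ in a..t, g τ) (g t) t := by
  have h := hg.ae_hasDerivAt_integral
  rw [uIcc_of_le hab.le] at h
  filter_upwards [h] with t ht hmem
  exact ht hmem a (left_mem_Icc.2 hab.le)

theorem derivWithin_primitive_ae_eq (hab : a < b) (hg : IntervalIntegrable g volume a b) (c : ℂ) :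
    derivWithin (fun t => c + ∫ τ in a..t, g τ) (Icc a b) =ᵐ[volume.restrict (Icc a b)] g := by
  rw [EventuallyEq, ae_restrict_iff' measurableSet_Icc]
  filter_upwards [ae_hasDerivAt_primitive hab hg] with t ht hmem
  exact ((ht hmem).const_add c).hasDerivWithinAt.derivWithin (uniqueDiffOn_Icc hab t hmem)

/-- The fundamental theorem of calculus for absolutely continuous functions with values in `ℂ`. -/
theorem eq_add_integral_derivWithin (hab : a < b) (hy : AbsolutelyContinuousOnInterval y a b)
    (hg : IntervalIntegrable (derivWithin y (Icc a b)) volume a b) {t : ℝ} (ht : t ∈ Icc a b) :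
    y t = y a + ∫ τ in a..t, derivWithin y (Icc a b) τ := by
  obtain ⟨C, hC⟩ := (hy.sub
    (absolutelyContinuousOnInterval_primitive hab hg)).const_of_ae_hasDerivAt_zero (by
      rw [uIcc_of_le hab.le]
      filter_upwards [ae_hasDerivAt_of_ac hab hy, ae_hasDerivAt_primitive hab hg]
        with t h1 h2 hmem
      simpa using (h1 hmem).sub (h2 hmem))
  rw [uIcc_of_le hab.le] at hC
  have h1 := hC t ht
  have h2 := hC a (left_mem_Icc.2 hab.le)
  simp only [Pi.sub_apply, intervalIntegral.integral_same, sub_zero] at h1 h2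
  rw [h2, ← h1]
  ring

theorem intervalIntegrable_of_memLp (hab : a < b) {p : ℝ≥0∞} (hp : 1 ≤ p)
    (hg : MemLp g p (volume.restrict (Icc a b))) : IntervalIntegrable g volume a b :=
  (intervalIntegrable_iff_integrableOn_Icc_of_le hab.le).2 (hg.integrable hp)

theorem memLp_of_continuousOn {p : ℝ≥0∞} (hy : ContinuousOn y (Icc a b)) :
    MemLp y p (volume.restrict (Icc a b)) := by
  obtain ⟨C, hC⟩ := isCompact_Icc.exists_bound_of_continuousOn hy
  exact MemLp.of_bound (hy.aestronglyMeasurable measurableSet_Icc) C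
    ((ae_restrict_iff' measurableSet_Icc).2 (.of_forall hC))

theorem _root_.AbsolutelyContinuousOnInterval.continuousOn_Icc (hab : a < b)
    (hy : AbsolutelyContinuousOnInterval y a b) : ContinuousOn y (Icc a b) := by
  simpa [uIcc_of_le hab.le] using hy.continuousOn

end AbsolutelyContinuous

/-! ### Calculus in Sobolev spaces on an interval -/

section Calculus

variable {a b : ℝ} {p : ℝ≥0∞} {s : ℕ} {y z g : ℝ → ℂ}

theorem MemSobolev.absolutelyContinuous (hab : a < b) (hy : MemSobolev a b p (s + 1) y) :
    AbsolutelyContinuousOnInterval y a b := by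
  cases s with
  | zero => simpa using hy.2.1
  | succ s =>
    refine ContDiffOn.absolutelyContinuousOnInterval ?_
    rw [uIcc_of_le hab.le]
    exact hy.1.of_le (by exact_mod_cast Nat.le_add_left 1 s)

theorem MemSobolev.continuousOn (hab : a < b) (hy : MemSobolev a b p (s + 1) y) :
    ContinuousOn y (Icc a b) :=
  (hy.absolutelyContinuous hab).continuousOn_Icc hab

theorem MemSobolev.memSobolev_derivWithin (hab : a < b) (hy : MemSobolev a b p (s + 1) y) :
    MemSobolev a b p s (derivWithin y (Icc a b)) := by
  obtain ⟨h1, h2, h3⟩ := hy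
  cases s with
  | zero => simpa [MemSobolev] using h3
  | succ s =>
    rw [iteratedDerivWithin_succ'] at h2 h3
    refine ⟨?_, h2, h3⟩
    have h1' : ContDiffOn ℝ ((s : WithTop ℕ∞) + 1) y (Icc a b) := by exact_mod_cast h1
    exact ((contDiffOn_succ_iff_derivWithin (uniqueDiffOn_Icc hab)).1 h1').2.2

theorem MemSobolev.of_succ (hab : a < b) (hy : MemSobolev a b p (s + 1) y) :
    MemSobolev a b p s y := by
  cases s with
  | zero => exact memLp_of_continuousOn (hy.continuousOn hab)
  | succ s =>
    obtain ⟨h1, h2, h3⟩ := hy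
    refine ⟨h1.of_le (by exact_mod_cast Nat.le_succ s), ?_,
      memLp_of_continuousOn (h2.continuousOn_Icc hab)⟩
    refine ContDiffOn.absolutelyContinuousOnInterval ?_
    rw [uIcc_of_le hab.le]
    exact contDiffOn_nat_succ_iff_contDiffOn_one_iteratedDerivWithin (uniqueDiffOn_Icc hab) |>.1
      h1 |>.2

theorem MemSobolev.mono (hab : a < b) {s' : ℕ} (h : s' ≤ s) (hy : MemSobolev a b p s y) :
    MemSobolev a b p s' y := by
  induction s, h using Nat.le_induction with
  | base => exact hy
  | succ k _ ih => exact ih (hy.of_succ hab)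

theorem MemSobolev.memLp (hab : a < b) (hy : MemSobolev a b p s y) :
    MemLp y p (volume.restrict (Icc a b)) :=
  hy.mono hab (Nat.zero_le s)

theorem MemSobolev.memSobolev_iteratedDerivWithin (hab : a < b) {j : ℕ}
    (hy : MemSobolev a b p (s + j) y) :
    MemSobolev a b p s (iteratedDerivWithin j y (Icc a b)) := by
  induction j generalizing y with
  | zero => simpa using hy
  | succ j ih =>
    rw [iteratedDerivWithin_succ']
    exact ih (MemSobolev.memSobolev_derivWithin hab hy)

theorem MemSobolev.memLp_iteratedDerivWithin (hab : a < b) {k : ℕ} (hk : k ≤ s)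
    (hy : MemSobolev a b p s y) :
    MemLp (iteratedDerivWithin k y (Icc a b)) p (volume.restrict (Icc a b)) :=
  MemSobolev.memSobolev_iteratedDerivWithin (s := 0) hab (hy.mono hab (by omega))

theorem sobolevNorm_zero_order :
    sobolevNorm a b p 0 y = eLpNorm y p (volume.restrict (Icc a b)) := by
  simp [sobolevNorm]

theorem sobolevNorm_succ : sobolevNorm a b p (s + 1) y =
    eLpNorm y p (volume.restrict (Icc a b)) + sobolevNorm a b p s (derivWithin y (Icc a b)) := by
  rw [sobolevNorm, Finset.sum_range_succ', add_comm]
  simp [sobolevNorm, iteratedDerivWithin_succ']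

theorem sobolevNorm_mono {s' : ℕ} (h : s' ≤ s) : sobolevNorm a b p s' y ≤ sobolevNorm a b p s y :=
  Finset.sum_le_sum_of_subset (Finset.range_mono (by omega))

theorem eLpNorm_le_sobolevNorm :
    eLpNorm y p (volume.restrict (Icc a b)) ≤ sobolevNorm a b p s y := by
  rw [← sobolevNorm_zero_order]
  exact sobolevNorm_mono (Nat.zero_le s)

theorem sobolevNorm_derivWithin_le :
    sobolevNorm a b p s (derivWithin y (Icc a b)) ≤ sobolevNorm a b p (s + 1) y := by
  rw [sobolevNorm_succ]
  exact le_add_self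

theorem sobolevNorm_iteratedDerivWithin_le {j : ℕ} :
    sobolevNorm a b p s (iteratedDerivWithin j y (Icc a b)) ≤ sobolevNorm a b p (s + j) y := by
  induction j generalizing y with
  | zero => simp
  | succ j ih =>
    rw [iteratedDerivWithin_succ']
    exact ih.trans sobolevNorm_derivWithin_le

theorem MemSobolev.sobolevNorm_lt_top (hab : a < b) (hy : MemSobolev a b p s y) :
    sobolevNorm a b p s y < ∞ :=
  ENNReal.sum_lt_top.2 fun _ hk =>
    (hy.memLp_iteratedDerivWithin hab (Nat.lt_succ_iff.1 (Finset.mem_range.1 hk))).2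

theorem MemSobolev.eqOn_of_ae_eq (hab : a < b) (hs : 1 ≤ s) (hy : MemSobolev a b p s y)
    (hz : MemSobolev a b p s z) (h : y =ᵐ[volume.restrict (Icc a b)] z) : EqOn y z (Icc a b) := by
  obtain ⟨s, rfl⟩ := Nat.exists_eq_add_of_le' hs
  exact Measure.eqOn_Icc_of_ae_eq volume hab.ne h (hy.continuousOn hab) (hz.continuousOn hab)

theorem sobolevNorm_congr (h : EqOn y z (Icc a b)) :
    sobolevNorm a b p s y = sobolevNorm a b p s z :=
  Finset.sum_congr rfl fun _ _ => eLpNorm_congr_ae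
    ((ae_restrict_iff' measurableSet_Icc).2 (.of_forall (iteratedDerivWithin_congr h)))

theorem sobolevNorm_congr_ae (hab : a < b) (hy : MemSobolev a b p s y) (hz : MemSobolev a b p s z)
    (h : y =ᵐ[volume.restrict (Icc a b)] z) : sobolevNorm a b p s y = sobolevNorm a b p s z := by
  rcases Nat.eq_zero_or_pos s with rfl | hs
  · rw [sobolevNorm_zero_order, sobolevNorm_zero_order, eLpNorm_congr_ae h]
  · exact sobolevNorm_congr (hy.eqOn_of_ae_eq hab hs hz h)

theorem MemSobolev.congr (h : EqOn y z (Icc a b)) (hab : a < b) (hy : MemSobolev a b p s y) :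
    MemSobolev a b p s z := by
  have hae : ∀ k, iteratedDerivWithin k y (Icc a b) =ᵐ[volume.restrict (Icc a b)]
      iteratedDerivWithin k z (Icc a b) := fun k =>
    (ae_restrict_iff' measurableSet_Icc).2 (.of_forall (iteratedDerivWithin_congr h))
  cases s with
  | zero => exact (memLp_congr_ae (by simpa using hae 0)).1 hy
  | succ s =>
    exact ⟨hy.1.congr fun t ht => (h ht).symm, ac_congr hab hy.2.1 (iteratedDerivWithin_congr h),
      (memLp_congr_ae (hae _)).1 hy.2.2⟩

/-- An absolutely continuous function whose derivative agrees almost everywhere with a function of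
class `W_p^s` is of class `W_p^{s+1}`: for `s ≥ 1` the derivative then agrees with that function at
every point of `[a,b]`, since both are represented by the same integral. -/
theorem MemSobolev.of_derivWithin_ae_eq (hab : a < b) (hp : 1 ≤ p)
    (hy : AbsolutelyContinuousOnInterval y a b) (hg : MemSobolev a b p s g)
    (h : derivWithin y (Icc a b) =ᵐ[volume.restrict (Icc a b)] g) :
    MemSobolev a b p (s + 1) y := by
  cases s with
  | zero =>
    refine ⟨by simpa using hy.continuousOn_Icc hab, by simpa using hy, ?_⟩
    simpa using (memLp_congr_ae h).2 hg
  | succ s =>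
    have hgi : IntervalIntegrable g volume a b :=
      intervalIntegrable_of_memLp hab hp (hg.memLp hab)
    have hgc := hg.continuousOn hab
    have hyi : IntervalIntegrable (derivWithin y (Icc a b)) volume a b :=
      intervalIntegrable_of_memLp hab hp ((memLp_congr_ae h).2 (hg.memLp hab))
    have hrep : EqOn y (fun t => y a + ∫ τ in a..t, g τ) (Icc a b) := fun t ht => by
      rw [eq_add_integral_derivWithin hab hy hyi ht]
      congr 1
      refine intervalIntegral.integral_congr_ae_restrict ?_
      refine ae_restrict_of_ae_restrict_of_subset ?_ h
      rw [uIoc_of_le ht.1]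
      exact Ioc_subset_Icc_self.trans (Icc_subset_Icc_right ht.2)
    have hder : ∀ t ∈ Icc a b, HasDerivWithinAt y (g t) (Icc a b) t := fun t ht => by
      refine HasDerivWithinAt.congr ?_ hrep (hrep ht)
      refine HasDerivWithinAt.const_add _ ?_
      have : Fact (t ∈ Icc a b) := ⟨ht⟩
      refine intervalIntegral.integral_hasDerivWithinAt_right (hgi.mono_set ?_)
        (hgc.stronglyMeasurableAtFilter_nhdsWithin measurableSet_Icc t) (hgc t ht)
      rw [uIcc_of_le ht.1, uIcc_of_le hab.le]
      exact Icc_subset_Icc_right ht.2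
    have hEq : EqOn g (derivWithin y (Icc a b)) (Icc a b) := fun t ht =>
      ((hder t ht).derivWithin (uniqueDiffOn_Icc hab t ht)).symm
    have hg' := hg.congr hEq hab
    refine ⟨?_, ?_, ?_⟩
    · have : ContDiffOn ℝ ((s : WithTop ℕ∞) + 1) y (Icc a b) :=
        (contDiffOn_succ_iff_derivWithin (uniqueDiffOn_Icc hab)).2
          ⟨fun t ht => (hder t ht).differentiableWithinAt, by simp, hg'.1⟩
      exact_mod_cast this
    · rw [iteratedDerivWithin_succ']
      exact hg'.2.1
    · rw [iteratedDerivWithin_succ']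
      exact hg'.2.2

theorem sobolevNorm_succ_of_derivWithin_ae_eq (hab : a < b) (hy : MemSobolev a b p (s + 1) y)
    (hg : MemSobolev a b p s g)
    (h : derivWithin y (Icc a b) =ᵐ[volume.restrict (Icc a b)] g) :
    sobolevNorm a b p (s + 1) y =
      eLpNorm y p (volume.restrict (Icc a b)) + sobolevNorm a b p s g := by
  rw [sobolevNorm_succ, sobolevNorm_congr_ae hab (MemSobolev.memSobolev_derivWithin hab hy) hg h]

theorem MemSobolev.primitive (hab : a < b) (hp : 1 ≤ p) (hg : MemSobolev a b p s g) (c : ℂ) :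
    MemSobolev a b p (s + 1) (fun t => c + ∫ τ in a..t, g τ) := by
  have hgi := intervalIntegrable_of_memLp hab hp (hg.memLp hab)
  refine .of_derivWithin_ae_eq hab hp ?_ hg (derivWithin_primitive_ae_eq hab hgi c)
  exact (contDiff_const (n := 1)).contDiffOn.absolutelyContinuousOnInterval.add
    (absolutelyContinuousOnInterval_primitive hab hgi)

theorem iteratedDerivWithin_add_ae_eq (hab : a < b) {k : ℕ} (hk : k ≤ s)
    (hy : MemSobolev a b p s y) (hz : MemSobolev a b p s z) :
    iteratedDerivWithin k (y + z) (Icc a b) =ᵐ[volume.restrict (Icc a b)]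
      iteratedDerivWithin k y (Icc a b) + iteratedDerivWithin k z (Icc a b) := by
  replace hy := hy.mono hab hk
  replace hz := hz.mono hab hk
  cases k with
  | zero => simp
  | succ k =>
    have hu := uniqueDiffOn_Icc hab
    have hE : EqOn (iteratedDerivWithin k (y + z) (Icc a b))
        (iteratedDerivWithin k y (Icc a b) + iteratedDerivWithin k z (Icc a b)) (Icc a b) :=
      fun t ht => iteratedDerivWithin_add ht hu (hy.1 t ht) (hz.1 t ht)
    filter_upwards [ae_differentiableWithinAt_of_ac hab hy.2.1,
      ae_differentiableWithinAt_of_ac hab hz.2.1, ae_restrict_mem measurableSet_Icc] with t h1 h2 ht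
    rw [Pi.add_apply, iteratedDerivWithin_succ, iteratedDerivWithin_succ,
      iteratedDerivWithin_succ, ← derivWithin_add h1 h2]
    exact derivWithin_congr hE (hE ht)

theorem sobolevNorm_add_le (hab : a < b) (hp : 1 ≤ p) (hy : MemSobolev a b p s y)
    (hz : MemSobolev a b p s z) :
    sobolevNorm a b p s (y + z) ≤ sobolevNorm a b p s y + sobolevNorm a b p s z := by
  rw [sobolevNorm, sobolevNorm, sobolevNorm, ← Finset.sum_add_distrib]
  refine Finset.sum_le_sum fun k hk => ?_
  have hk' : k ≤ s := Nat.lt_succ_iff.1 (Finset.mem_range.1 hk)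
  rw [eLpNorm_congr_ae (iteratedDerivWithin_add_ae_eq hab hk' hy hz)]
  exact eLpNorm_add_le (hy.memLp_iteratedDerivWithin hab hk').1
    (hz.memLp_iteratedDerivWithin hab hk').1 hp

theorem sobolevNorm_smul (c : ℂ) :
    sobolevNorm a b p s (c • y) = ‖c‖ₑ * sobolevNorm a b p s y := by
  rw [sobolevNorm, sobolevNorm, Finset.mul_sum]
  refine Finset.sum_congr rfl fun k _ => ?_
  rw [← eLpNorm_const_smul]
  congr 1
  funext t
  exact iteratedDerivWithin_const_smul_field c y

theorem sobolevNorm_zero : sobolevNorm a b p s 0 = 0 := by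
  simpa using sobolevNorm_smul (a := a) (b := b) (p := p) (s := s) (y := 0) 0

theorem MemSobolev.sum (hab : a < b) {ι : Type*} {S : Finset ι} {f : ι → ℝ → ℂ}
    (hf : ∀ i ∈ S, MemSobolev a b p s (f i)) : MemSobolev a b p s (∑ i ∈ S, f i) :=
  (sobolev hab p s).sum_mem hf

theorem sobolevNorm_sum_le (hab : a < b) (hp : 1 ≤ p) {ι : Type*} {S : Finset ι} {f : ι → ℝ → ℂ}
    (hf : ∀ i ∈ S, MemSobolev a b p s (f i)) :
    sobolevNorm a b p s (∑ i ∈ S, f i) ≤ ∑ i ∈ S, sobolevNorm a b p s (f i) := by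
  classical
  induction S using Finset.induction_on with
  | empty => simp [sobolevNorm_zero]
  | insert i S hi ih =>
    rw [Finset.sum_insert hi, Finset.sum_insert hi]
    have hS : ∀ j ∈ S, MemSobolev a b p s (f j) := fun j hj => hf j (Finset.mem_insert_of_mem hj)
    exact (sobolevNorm_add_le hab hp (hf i (Finset.mem_insert_self i S))
      (MemSobolev.sum hab hS)).trans (add_le_add le_rfl (ih hS))

end Calculus

/-! ### Embedding and multiplication estimates -/

section Estimates

variable {a b : ℝ} {p : ℝ≥0∞} {s : ℕ} {y z g : ℝ → ℂ}

theorem enorm_primitive_le {t : ℝ} (ht : t ∈ Icc a b) :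
    ‖∫ τ in a..t, g τ‖ₑ ≤ eLpNorm g 1 (volume.restrict (Icc a b)) := by
  rw [eLpNorm_one_eq_lintegral_enorm, intervalIntegral.integral_of_le ht.1]
  exact (enorm_integral_le_lintegral_enorm _).trans
    (lintegral_mono_set (Ioc_subset_Icc_self.trans (Icc_subset_Icc_right ht.2)))

variable (a b) in
theorem exists_eLpNorm_one_le (hp : 1 ≤ p) :
    ∃ C : ℝ≥0, ∀ g : ℝ → ℂ, MemLp g p (volume.restrict (Icc a b)) →
      eLpNorm g 1 (volume.restrict (Icc a b)) ≤ C * eLpNorm g p (volume.restrict (Icc a b)) := by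
  have hexp : 0 ≤ 1 / (1 : ℝ≥0∞).toReal - 1 / p.toReal := by
    rcases eq_or_ne p ∞ with rfl | hp'
    · simp
    · have : 1 ≤ p.toReal := by
        simpa using ENNReal.toReal_mono hp' hp
      simpa using inv_le_one_of_one_le₀ this
  refine ⟨((volume.restrict (Icc a b)) univ ^ (1 / (1 : ℝ≥0∞).toReal - 1 / p.toReal)).toNNReal,
    fun g hg => ?_⟩
  rw [ENNReal.coe_toNNReal (ENNReal.rpow_ne_top_of_nonneg hexp (measure_ne_top _ _)), mul_comm]
  exact eLpNorm_le_eLpNorm_mul_rpow_measure_univ hp hg.1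

/-- The embedding `W_p^1 ⊆ L_∞`, with values bounded pointwise on `[a,b]`. -/
theorem exists_enorm_le_sobolevNorm_one (hab : a < b) (hp : 1 ≤ p) :
    ∃ C : ℝ≥0, ∀ y, MemSobolev a b p 1 y → ∀ t ∈ Icc a b, ‖y t‖ₑ ≤ C * sobolevNorm a b p 1 y := by
  obtain ⟨K, hK⟩ := exists_eLpNorm_one_le a b hp
  set V : ℝ≥0∞ := ENNReal.ofReal (b - a) with hV
  have hV0 : V ≠ 0 := by simp [hV, hab]
  have hVt : V ≠ ∞ := ENNReal.ofReal_ne_top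
  have hVu : (volume.restrict (Icc a b)) univ = V := by simp [hV]
  refine ⟨(V⁻¹ * K + 2 * K).toNNReal, fun y hy t ht => ?_⟩
  rw [ENNReal.coe_toNNReal (by finiteness)]
  have hy' := hy.memSobolev_derivWithin hab
  set J := eLpNorm (derivWithin y (Icc a b)) 1 (volume.restrict (Icc a b)) with hJ
  have hyi := intervalIntegrable_of_memLp hab hp hy'
  have hpt : ∀ τ ∈ Icc a b, ‖y t‖ₑ ≤ ‖y τ‖ₑ + 2 * J := fun τ hτ => by
    have e : y t = y τ + (∫ x in a..t, derivWithin y (Icc a b) x) -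
        ∫ x in a..τ, derivWithin y (Icc a b) x := by
      rw [eq_add_integral_derivWithin hab (hy.absolutelyContinuous hab) hyi ht,
        eq_add_integral_derivWithin hab (hy.absolutelyContinuous hab) hyi hτ]
      ring
    rw [e, two_mul, ← add_assoc]
    exact (enorm_sub_le.trans (add_le_add_left (enorm_add_le _ _) _)).trans
      (add_le_add (add_le_add le_rfl (enorm_primitive_le ht)) (enorm_primitive_le hτ))
  -- Averaging over `τ ∈ [a,b]`.
  have havg : ‖y t‖ₑ * V ≤ eLpNorm y 1 (volume.restrict (Icc a b)) + 2 * J * V := by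
    rw [eLpNorm_one_eq_lintegral_enorm, ← hVu, ← lintegral_const, ← lintegral_const,
      ← lintegral_add_right _ measurable_const]
    exact lintegral_mono_ae ((ae_restrict_iff' measurableSet_Icc).2 (.of_forall hpt))
  have h1 : ‖y t‖ₑ ≤ V⁻¹ * eLpNorm y 1 (volume.restrict (Icc a b)) + 2 * J := by
    calc ‖y t‖ₑ = V⁻¹ * (‖y t‖ₑ * V) := by
          rw [mul_comm, mul_assoc, ENNReal.mul_inv_cancel hV0 hVt, mul_one]
      _ ≤ V⁻¹ * (eLpNorm y 1 (volume.restrict (Icc a b)) + 2 * J * V) := by gcongr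
      _ = V⁻¹ * eLpNorm y 1 (volume.restrict (Icc a b)) + 2 * J := by
          rw [mul_add, mul_comm (2 * J), ← mul_assoc, ENNReal.inv_mul_cancel hV0 hVt, one_mul]
  refine h1.trans ?_
  rw [add_mul, mul_assoc, mul_assoc]
  gcongr
  · exact (hK y (hy.memLp hab)).trans (by gcongr; exact eLpNorm_le_sobolevNorm)
  · refine (hK _ hy').trans ?_
    gcongr
    rw [← sobolevNorm_zero_order]
    exact sobolevNorm_derivWithin_le

theorem exists_sobolevNorm_primitive_le (hab : a < b) (hp : 1 ≤ p) (s : ℕ) :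
    ∃ C : ℝ≥0, ∀ g, MemSobolev a b p s g → ∀ c : ℂ,
      sobolevNorm a b p (s + 1) (fun t => c + ∫ τ in a..t, g τ) ≤
        C * (‖c‖ₑ + sobolevNorm a b p s g) := by
  obtain ⟨K, hK⟩ := exists_eLpNorm_one_le a b hp
  set M : ℝ≥0∞ := (volume.restrict (Icc a b)) univ ^ p.toReal⁻¹ with hM
  have hMt : M ≠ ∞ := ENNReal.rpow_ne_top_of_nonneg (by positivity) (measure_ne_top _ _)
  refine ⟨((1 + K) * M + 1).toNNReal, fun g hg c => ?_⟩
  rw [ENNReal.coe_toNNReal (by finiteness)]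
  have hgi := intervalIntegrable_of_memLp hab hp (hg.memLp hab)
  rw [sobolevNorm_succ_of_derivWithin_ae_eq hab (hg.primitive hab hp c) hg
    (derivWithin_primitive_ae_eq hab hgi c), add_mul, one_mul]
  refine add_le_add ?_ le_add_self
  have hsup : ∀ t ∈ Icc a b, ‖c + ∫ τ in a..t, g τ‖ₑ ≤
      (1 + K) * (‖c‖ₑ + sobolevNorm a b p s g) := fun t ht => by
    refine (enorm_add_le _ _).trans ?_
    have h1 : ‖∫ τ in a..t, g τ‖ₑ ≤ K * sobolevNorm a b p s g :=
      (enorm_primitive_le ht).trans ((hK g (hg.memLp hab)).trans (by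
        gcongr; exact eLpNorm_le_sobolevNorm))
    calc ‖c‖ₑ + ‖∫ τ in a..t, g τ‖ₑ ≤
        (‖c‖ₑ + sobolevNorm a b p s g) + K * (‖c‖ₑ + sobolevNorm a b p s g) :=
          add_le_add le_self_add (h1.trans (by gcongr; exact le_add_self))
      _ = (1 + K) * (‖c‖ₑ + sobolevNorm a b p s g) := by ring
  refine (eLpNorm_le_of_ae_enorm_bound ((ae_restrict_iff' measurableSet_Icc).2
    (.of_forall hsup))).trans (le_of_eq ?_)
  rw [smul_eq_mul]
  ring

/-- Multiplication is a bounded bilinear map `W_p^n × W_p^{n+1} → W_p^n`. -/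
theorem exists_sobolevNorm_mul_le (hab : a < b) (hp : 1 ≤ p) (n : ℕ) :
    ∃ C : ℝ≥0, ∀ y z, MemSobolev a b p n y → MemSobolev a b p (n + 1) z →
      MemSobolev a b p n (y * z) ∧
        sobolevNorm a b p n (y * z) ≤ C * (sobolevNorm a b p n y * sobolevNorm a b p (n + 1) z) := by
  obtain ⟨K, hK⟩ := exists_enorm_le_sobolevNorm_one (p := p) hab hp
  have hL : ∀ y z, MemLp y p (volume.restrict (Icc a b)) → MemSobolev a b p 1 z →
      MemLp (y * z) p (volume.restrict (Icc a b)) ∧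
      eLpNorm (y * z) p (volume.restrict (Icc a b)) ≤
        K * (eLpNorm y p (volume.restrict (Icc a b)) * sobolevNorm a b p 1 z) := by
    intro y z hy hz
    have hzt := hz.sobolevNorm_lt_top hab
    have hle : eLpNorm (y * z) p (volume.restrict (Icc a b)) ≤
        (K * sobolevNorm a b p 1 z) * eLpNorm y p (volume.restrict (Icc a b)) := by
      refine eLpNorm_le_mul_eLpNorm_of_ae_le_mul'' p hy.1 ?_
      refine (ae_restrict_iff' measurableSet_Icc).2 (.of_forall fun t ht => ?_)
      rw [Pi.mul_apply, enorm_mul, mul_comm]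
      gcongr
      exact hK z hz t ht
    refine ⟨⟨hy.1.mul (hz.memLp hab).1, hle.trans_lt ?_⟩, hle.trans (le_of_eq (by ring))⟩
    exact ENNReal.mul_lt_top (ENNReal.mul_lt_top (by simp) hzt) hy.2
  induction n with
  | zero =>
    refine ⟨K, fun y z hy hz => ?_⟩
    rw [sobolevNorm_zero_order, sobolevNorm_zero_order]
    exact hL y z hy hz
  | succ n ih =>
    obtain ⟨C, hC⟩ := ih
    refine ⟨K + C + C, fun y z hy hz => ?_⟩
    have hz1 : MemSobolev a b p (n + 1) z := hz.of_succ hab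
    obtain ⟨m1, b1⟩ := hC _ _ (hy.memSobolev_derivWithin hab) hz1
    obtain ⟨m2, b2⟩ := hC _ _ (hy.of_succ hab) (hz.memSobolev_derivWithin hab)
    have hac : AbsolutelyContinuousOnInterval (y * z) a b :=
      (hy.absolutelyContinuous hab).smul (hz1.absolutelyContinuous hab)
    have hder : derivWithin (y * z) (Icc a b) =ᵐ[volume.restrict (Icc a b)]
        derivWithin y (Icc a b) * z + y * derivWithin z (Icc a b) := by
      filter_upwards [ae_differentiableWithinAt_of_ac hab (hy.absolutelyContinuous hab),
        ae_differentiableWithinAt_of_ac hab (hz1.absolutelyContinuous hab)] with t h1 h2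
      exact derivWithin_mul h1 h2
    have hm := MemSobolev.of_derivWithin_ae_eq hab hp hac (m1.add hab m2) hder
    refine ⟨hm, ?_⟩
    rw [sobolevNorm_succ_of_derivWithin_ae_eq hab hm (m1.add hab m2) hder]
    obtain ⟨-, b0⟩ := hL y z (hy.memLp hab) (hz1.mono hab (by omega))
    push_cast
    rw [add_mul, add_mul, add_assoc]
    refine add_le_add (b0.trans ?_) ((sobolevNorm_add_le hab hp m1 m2).trans
      (add_le_add (b1.trans ?_) (b2.trans ?_)))
    · gcongr
      · exact eLpNorm_le_sobolevNorm
      · exact sobolevNorm_mono (by omega)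
    · gcongr
      · exact sobolevNorm_derivWithin_le
      · exact sobolevNorm_mono (by omega)
    · gcongr
      · exact sobolevNorm_mono (by omega)
      · exact sobolevNorm_derivWithin_le

end Estimates

/-! ### Sobolev spaces as complete seminormed spaces -/

section SobolevSpace

variable {a b : ℝ} {hab : a < b} {p : ℝ≥0∞} {s : ℕ}

/-- The space `W_p^s([a,b]; ℂ)` with its Sobolev norm. Since its elements are functions on `ℝ`, this
is only a seminorm: functions that agree almost everywhere on `[a,b]` are at distance zero. The type
is a synonym of `sobolev hab p s`, which would otherwise carry the topology of pointwise convergence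
as a subspace of `ℝ → ℂ`. -/
def SobolevSpace (hab : a < b) (p : ℝ≥0∞) (s : ℕ) : Type := sobolev hab p s

namespace SobolevSpace

instance : AddCommGroup (SobolevSpace hab p s) := inferInstanceAs (AddCommGroup (sobolev hab p s))

instance : Module ℂ (SobolevSpace hab p s) := inferInstanceAs (Module ℂ (sobolev hab p s))

/-- The function on `ℝ` underlying an element of `W_p^s`. -/
def toFun (y : SobolevSpace hab p s) : ℝ → ℂ := (show sobolev hab p s from y).1

instance : CoeFun (SobolevSpace hab p s) (fun _ => ℝ → ℂ) := ⟨toFun⟩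

/-- The element of `W_p^s` given by a function of class `W_p^s`. -/
def mk (y : ℝ → ℂ) (hy : MemSobolev a b p s y) : SobolevSpace hab p s :=
  (⟨y, hy⟩ : sobolev hab p s)

theorem coe_mk (y : ℝ → ℂ) (hy : MemSobolev a b p s y) :
    ((mk y hy : SobolevSpace hab p s) : ℝ → ℂ) = y := rfl

theorem coe_add (y z : SobolevSpace hab p s) : ((y + z : SobolevSpace hab p s) : ℝ → ℂ) = y + z :=
  rfl

theorem coe_sub (y z : SobolevSpace hab p s) : ((y - z : SobolevSpace hab p s) : ℝ → ℂ) = y - z :=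
  rfl

theorem coe_smul (c : ℂ) (y : SobolevSpace hab p s) :
    ((c • y : SobolevSpace hab p s) : ℝ → ℂ) = c • (y : ℝ → ℂ) := rfl

theorem memSobolev (y : SobolevSpace hab p s) : MemSobolev a b p s y :=
  (show sobolev hab p s from y).2

variable [Fact (1 ≤ p)]

noncomputable instance : SeminormedAddCommGroup (SobolevSpace hab p s) :=
  AddGroupSeminorm.toSeminormedAddCommGroup
    { toFun := fun y => (sobolevNorm a b p s y).toReal
      map_zero' := (congrArg ENNReal.toReal sobolevNorm_zero).trans ENNReal.toReal_zero
      add_le' := fun y z => by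
        have hy := y.memSobolev.sobolevNorm_lt_top hab
        have hz := z.memSobolev.sobolevNorm_lt_top hab
        rw [← ENNReal.toReal_add hy.ne hz.ne]
        exact ENNReal.toReal_mono (ENNReal.add_lt_top.2 ⟨hy, hz⟩).ne
          (sobolevNorm_add_le hab Fact.out y.memSobolev z.memSobolev)
      neg' := fun y => by
        have h := sobolevNorm_smul (a := a) (b := b) (p := p) (s := s) (y := y) (-1)
        rw [neg_one_smul, enorm_neg, enorm_one, one_mul] at h
        exact congrArg ENNReal.toReal h }

theorem norm_def (y : SobolevSpace hab p s) : ‖y‖ = (sobolevNorm a b p s y).toReal := rfl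

theorem enorm_def (y : SobolevSpace hab p s) : ‖y‖ₑ = sobolevNorm a b p s y := by
  rw [← ofReal_norm, norm_def, ENNReal.ofReal_toReal (y.memSobolev.sobolevNorm_lt_top hab).ne]

theorem edist_def (y z : SobolevSpace hab p s) :
    edist y z = sobolevNorm a b p s (y - z : SobolevSpace hab p s) := by
  rw [edist_eq_enorm_sub, enorm_def]

noncomputable instance : NormedSpace ℂ (SobolevSpace hab p s) where
  norm_smul_le c y := by
    rw [norm_def, norm_def]
    refine le_of_eq ?_
    have h := congrArg ENNReal.toReal
      (sobolevNorm_smul (a := a) (b := b) (p := p) (s := s) (y := y) c)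
    rw [ENNReal.toReal_mul, toReal_enorm] at h
    exact h

/-- The null functions of the Sobolev norm are those that vanish almost everywhere: for `s ≥ 1` such
a function is continuous, hence zero on `[a,b]` together with its derivatives. -/
theorem inseparable_iff_ae_eq {y z : SobolevSpace hab p s} :
    Inseparable y z ↔ (y : ℝ → ℂ) =ᵐ[volume.restrict (Icc a b)] z := by
  rw [EMetric.inseparable_iff, edist_def]
  have hmem := (y - z).memSobolev
  constructor
  · intro h
    have h0 : eLpNorm (y - z : SobolevSpace hab p s) p (volume.restrict (Icc a b)) = 0 :=
      le_antisymm (eLpNorm_le_sobolevNorm.trans h.le) bot_le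
    rw [eLpNorm_eq_zero_iff (hmem.memLp hab).1 (one_pos.trans_le Fact.out).ne'] at h0
    filter_upwards [h0] with t ht
    exact sub_eq_zero.1 ht
  · intro h
    rw [sobolevNorm_congr_ae hab hmem (MemSobolev.zero a b p s)
      (h.mono fun t ht => sub_eq_zero.2 ht), sobolevNorm_zero]

/-- The derivative `W_p^{s+1} → W_p^s`. It is linear only up to a null set when `s = 0`. -/
noncomputable def deriv (y : SobolevSpace hab p (s + 1)) : SobolevSpace hab p s :=
  mk (derivWithin y (Icc a b)) (y.memSobolev.memSobolev_derivWithin hab)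

/-- The primitive of `x.2 ∈ W_p^s` with value `x.1` at `a`. -/
noncomputable def primitive (x : ℂ × SobolevSpace hab p s) : SobolevSpace hab p (s + 1) :=
  mk (fun t => x.1 + ∫ τ in a..t, x.2 τ) (x.2.memSobolev.primitive hab Fact.out x.1)

theorem lipschitzWith_deriv : LipschitzWith 1 (deriv : SobolevSpace hab p (s + 1) → _) := by
  intro y z
  have h : derivWithin (y - z : SobolevSpace hab p (s + 1)) (Icc a b)
      =ᵐ[volume.restrict (Icc a b)] (deriv y - deriv z : SobolevSpace hab p s) := by
    filter_upwards [ae_differentiableWithinAt_of_ac hab (y.memSobolev.absolutelyContinuous hab),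
      ae_differentiableWithinAt_of_ac hab (z.memSobolev.absolutelyContinuous hab)] with t h1 h2
    exact derivWithin_sub h1 h2
  rw [edist_def, edist_def, ENNReal.coe_one, one_mul, ← sobolevNorm_congr_ae hab
    ((y - z).memSobolev.memSobolev_derivWithin hab) (deriv y - deriv z).memSobolev h]
  exact sobolevNorm_derivWithin_le

theorem exists_lipschitzWith_eval : ∃ C : ℝ≥0,
    LipschitzWith C fun y : SobolevSpace hab p (s + 1) => y a := by
  obtain ⟨C, hC⟩ := exists_enorm_le_sobolevNorm_one (p := p) hab Fact.out
  refine ⟨C, fun y z => ?_⟩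
  rw [edist_eq_enorm_sub, edist_def]
  exact (hC _ ((y - z).memSobolev.mono hab (by omega)) a (left_mem_Icc.2 hab.le)).trans
    (by gcongr; exact sobolevNorm_mono (by omega))

theorem continuous_primitive : Continuous (primitive : ℂ × SobolevSpace hab p s → _) := by
  obtain ⟨C, hC⟩ := exists_sobolevNorm_primitive_le (p := p) hab Fact.out s
  refine (?_ : LipschitzWith (C * 2) _).continuous
  intro x x'
  have hint : ∀ w : SobolevSpace hab p s, ∀ t ∈ Icc a b, IntervalIntegrable w volume a t :=
    fun w t ht => (intervalIntegrable_of_memLp hab Fact.out (w.memSobolev.memLp hab)).mono_set (by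
      rw [uIcc_of_le ht.1, uIcc_of_le hab.le]; exact Icc_subset_Icc_right ht.2)
  have h : EqOn (primitive x - primitive x' : SobolevSpace hab p (s + 1))
      (fun t => (x.1 - x'.1) + ∫ τ in a..t, (x.2 - x'.2) τ) (Icc a b) := fun t ht => by
    have : ∫ τ in a..t, (x.2 - x'.2) τ = (∫ τ in a..t, x.2 τ) - ∫ τ in a..t, x'.2 τ :=
      intervalIntegral.integral_sub (hint _ t ht) (hint _ t ht)
    beta_reduce
    rw [this]
    simp only [coe_sub, Pi.sub_apply, primitive, coe_mk]
    ring
  rw [edist_def, sobolevNorm_congr h]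
  refine (hC _ (x.2 - x'.2).memSobolev _).trans ?_
  rw [← enorm_def, ← edist_eq_enorm_sub, ← edist_eq_enorm_sub]
  push_cast
  rw [mul_assoc, two_mul, Prod.edist_eq]
  gcongr
  · exact le_max_left _ _
  · exact le_max_right _ _

theorem primitive_eval_deriv_inseparable (y : SobolevSpace hab p (s + 1)) :
    Inseparable (primitive (y a, deriv y)) y := by
  rw [inseparable_iff_ae_eq]
  refine (ae_restrict_iff' measurableSet_Icc).2 (.of_forall fun t ht => ?_)
  exact (eq_add_integral_derivWithin hab (y.memSobolev.absolutelyContinuous hab)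
    (intervalIntegrable_of_memLp hab Fact.out ((deriv y).memSobolev.memLp hab)) ht).symm

/-- Completeness follows by induction on `s` from that of `L_p`: up to null functions, an element of
`W_p^{s+1}` is the primitive determined by its value at `a` and its derivative in `W_p^s`. -/
instance : CompleteSpace (SobolevSpace hab p s) := by
  induction s with
  | zero =>
    refine UniformSpace.complete_of_cauchySeq_tendsto fun u hu => ?_
    have hiso : Isometry fun y : SobolevSpace hab p 0 =>
        (y.memSobolev.memLp hab).toLp (y : ℝ → ℂ) :=
      fun y z => by
        rw [Lp.edist_toLp_toLp, edist_def, sobolevNorm_zero_order]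
        rfl
    obtain ⟨f, hf⟩ := cauchySeq_tendsto_of_complete (hiso.uniformContinuous.comp_cauchySeq hu)
    refine ⟨mk f (Lp.memLp f), (hiso.isUniformInducing.isInducing.tendsto_nhds_iff).2 ?_⟩
    have hlim : (fun y : SobolevSpace hab p 0 => (y.memSobolev.memLp hab).toLp (y : ℝ → ℂ))
        (mk f (Lp.memLp f)) = f := Lp.toLp_coeFn f (Lp.memLp f)
    exact hf.mono_right (congrArg 𝓝 hlim.symm).le
  | succ s ih =>
    refine UniformSpace.complete_of_cauchySeq_tendsto fun u hu => ?_
    obtain ⟨C, hC⟩ := exists_lipschitzWith_eval (hab := hab) (p := p) (s := s)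
    obtain ⟨x, hx⟩ := cauchySeq_tendsto_of_complete 
      ((hC.uniformContinuous.prodMk lipschitzWith_deriv.uniformContinuous).comp_cauchySeq hu)
    refine ⟨primitive x, ?_⟩
    have h := tendsto_iff_edist_tendsto_0.1 ((continuous_primitive.tendsto x).comp hx)
    refine tendsto_iff_edist_tendsto_0.2 (h.congr fun k => ?_)
    exact edist_congr_right (EMetric.inseparable_iff.1 (primitive_eval_deriv_inseparable (u k)))

end SobolevSpace

end SobolevSpace

/-! ### The operators of a boundary-value problem -/

section Monomial

variable {a b : ℝ} {p : ℝ≥0∞} {s : ℕ}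

theorem MemSobolev.of_contDiffOn (hab : a < b) {y : ℝ → ℂ} (hy : ContDiffOn ℝ s y (Icc a b)) :
    MemSobolev a b p s y := by
  cases s with
  | zero => exact memLp_of_continuousOn hy.continuousOn
  | succ s =>
    have hu := uniqueDiffOn_Icc hab
    refine ⟨hy.of_le (by exact_mod_cast Nat.le_succ s),
      ContDiffOn.absolutelyContinuousOnInterval ?_,
      memLp_of_continuousOn (hy.continuousOn_iteratedDerivWithin le_rfl hu)⟩
    rw [uIcc_of_le hab.le]
    exact (contDiffOn_nat_succ_iff_contDiffOn_one_iteratedDerivWithin hu).1 hy |>.2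

theorem contDiff_ofReal_pow (j : ℕ) {k : WithTop ℕ∞} : ContDiff ℝ k fun t : ℝ => (t : ℂ) ^ j :=
  Complex.ofRealCLM.contDiff.pow j

theorem iteratedDerivWithin_ofReal_pow (hab : a < b) (j k : ℕ) :
    EqOn (iteratedDerivWithin k (fun t : ℝ => (t : ℂ) ^ j) (Icc a b))
      (fun t => (j.descFactorial k : ℂ) * (t : ℂ) ^ (j - k)) (Icc a b) := by
  induction k with
  | zero => intro t _; simp
  | succ k ih =>
    intro t ht
    rw [iteratedDerivWithin_succ, derivWithin_congr ih (ih ht)]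
    have h : HasDerivAt (fun t : ℝ => (t : ℂ) ^ (j - k)) ((j - k : ℕ) * (t : ℂ) ^ (j - k - 1)) t := by
      exact (hasDerivAt_pow (j - k) (t : ℂ)).comp_ofReal
    rw [(h.const_mul (j.descFactorial k : ℂ)).hasDerivWithinAt.derivWithin
      (uniqueDiffOn_Icc hab t ht), Nat.descFactorial_succ, Nat.sub_sub]
    push_cast
    ring

end Monomial

namespace BoundaryProblem

variable {a b : ℝ} {hab : a < b} {p : ℝ≥0∞} {n m r l : ℕ}

/-- The `i`-th component of `∑_{j<r} A_j y^{(j)}`, the part of `L y` that involves the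
coefficients. -/
noncomputable def lowerOrder (A : Fin r → ℝ → Matrix (Fin m) (Fin m) ℂ)
    (y : Fin m → SobolevSpace hab p (n + r)) (i : Fin m) : ℝ → ℂ :=
  ∑ j : Fin r, ∑ i', (fun t => A j t i i') * iteratedDerivWithin (j : ℕ) (y i') (Icc a b)

theorem L_apply (P : BoundaryProblem hab p n m r l) (y : Fin m → SobolevSpace hab p (n + r))
    (i : Fin m) :
    (fun t => P.L y t i) = iteratedDerivWithin r (y i) (Icc a b) + lowerOrder P.A y i := by
  funext t
  simp only [L, lowerOrder, Pi.add_apply, Finset.sum_apply, Matrix.mulVec, dotProduct,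
    Pi.mul_apply]
  rfl

theorem L_sub_L (P Q : BoundaryProblem hab p n m r l) (y : Fin m → SobolevSpace hab p (n + r))
    (i : Fin m) :
    (fun t => P.L y t i - Q.L y t i) = lowerOrder (fun j t => P.A j t - Q.A j t) y i := by
  have h : (fun t => P.L y t i - Q.L y t i) = (fun t => P.L y t i) - fun t => Q.L y t i := rfl
  rw [h, L_apply, L_apply, add_sub_add_left_eq_sub]
  funext t
  simp only [lowerOrder, Pi.sub_apply, Finset.sum_apply, Pi.mul_apply, Matrix.sub_apply, sub_mul,
    Finset.sum_sub_distrib]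

theorem _root_.norm_le_mul_norm_of_enorm_le {E F : Type*} [SeminormedAddCommGroup E]
    [SeminormedAddCommGroup F] {u : E} {v : F} {C : ℝ≥0} (h : ‖u‖ₑ ≤ C * ‖v‖ₑ) :
    ‖u‖ ≤ C * ‖v‖ := by
  have h' : (‖u‖₊ : ℝ≥0∞) ≤ C * ‖v‖₊ := h
  exact_mod_cast h'

variable [Fact (1 ≤ p)]

variable (hab p n m r) in
/-- The lower-order part is bounded by the norms of the coefficients. Applied to the difference of
two coefficient families this estimates the operator norm of the difference of two operators. -/
theorem exists_sobolevNorm_lowerOrder_le : ∃ C : ℝ≥0,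
    ∀ A : Fin r → ℝ → Matrix (Fin m) (Fin m) ℂ,
      (∀ j i i', MemSobolev a b p n (fun t => A j t i i')) →
      ∀ (y : Fin m → SobolevSpace hab p (n + r)) (i : Fin m),
        MemSobolev a b p n (lowerOrder A y i) ∧
        sobolevNorm a b p n (lowerOrder A y i) ≤
          C * (∑ j, ∑ i', sobolevNorm a b p n (fun t => A j t i i')) * ‖y‖ₑ := by
  obtain ⟨C, hC⟩ := exists_sobolevNorm_mul_le (p := p) hab Fact.out n
  refine ⟨C, fun A hA y i => ?_⟩
  -- As `j < r`, the factor `y^{(j)}` has one derivative more than the coefficient.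
  have hterm : ∀ (j : Fin r) (i' : Fin m), MemSobolev a b p n
        ((fun t => A j t i i') * iteratedDerivWithin (j : ℕ) (y i') (Icc a b)) ∧
      sobolevNorm a b p n
        ((fun t => A j t i i') * iteratedDerivWithin (j : ℕ) (y i') (Icc a b)) ≤
        C * sobolevNorm a b p n (fun t => A j t i i') * ‖y‖ₑ := by
    intro j i'
    have hj : n + 1 + j ≤ n + r := by omega
    obtain ⟨h1, h2⟩ := hC _ _ (hA j i i')
      (((y i').memSobolev.mono hab hj).memSobolev_iteratedDerivWithin hab)
    refine ⟨h1, h2.trans ?_⟩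
    rw [mul_assoc]
    gcongr
    refine (sobolevNorm_iteratedDerivWithin_le.trans (sobolevNorm_mono hj)).trans ?_
    rw [← SobolevSpace.enorm_def]
    exact ENNReal.coe_le_coe.2 (nnnorm_le_pi_nnnorm y i')
  have hsum : ∀ j ∈ Finset.univ, MemSobolev a b p n
      (∑ i', (fun t => A j t i i') * iteratedDerivWithin (j : ℕ) (y i') (Icc a b)) :=
    fun j _ => MemSobolev.sum hab fun i' _ => (hterm j i').1
  refine ⟨MemSobolev.sum hab hsum, (sobolevNorm_sum_le hab Fact.out hsum).trans ?_⟩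
  rw [Finset.mul_sum, Finset.sum_mul]
  refine Finset.sum_le_sum fun j _ => ?_
  rw [Finset.mul_sum, Finset.sum_mul]
  exact (sobolevNorm_sum_le hab Fact.out fun i' _ => (hterm j i').1).trans
    (Finset.sum_le_sum fun i' _ => (hterm j i').2)

theorem memSobolev_L (P : BoundaryProblem hab p n m r l)
    (y : Fin m → SobolevSpace hab p (n + r)) (i : Fin m) :
    MemSobolev a b p n (fun t => P.L y t i) := by
  rw [L_apply]
  obtain ⟨C, hC⟩ := exists_sobolevNorm_lowerOrder_le hab p n m r
  exact ((y i).memSobolev.memSobolev_iteratedDerivWithin hab).add hab (hC P.A P.A_mem y i).1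

/-- The `i`-th component of `L y`, as an element of `W_p^n`. -/
noncomputable def component (P : BoundaryProblem hab p n m r l)
    (y : Fin m → SobolevSpace hab p (n + r)) (i : Fin m) : SobolevSpace hab p n :=
  SobolevSpace.mk (fun t => P.L y t i) (P.memSobolev_L y i)

theorem component_add_inseparable (P : BoundaryProblem hab p n m r l)
    (y z : Fin m → SobolevSpace hab p (n + r)) (i : Fin m) :
    Inseparable (P.component (y + z) i) (P.component y i + P.component z i) := by
  rw [SobolevSpace.inseparable_iff_ae_eq]
  have h : ∀ i' k, k ≤ r → _ := fun i' k (hk : k ≤ r) =>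
    iteratedDerivWithin_add_ae_eq (k := k) hab (by omega) (y i').memSobolev (z i').memSobolev
  have hall : ∀ᵐ t ∂volume.restrict (Icc a b), ∀ (i' : Fin m) (k : Fin (r + 1)),
      iteratedDerivWithin (k : ℕ) ((y i' : ℝ → ℂ) + (z i' : ℝ → ℂ)) (Icc a b) t =
        iteratedDerivWithin (k : ℕ) (y i') (Icc a b) t +
          iteratedDerivWithin (k : ℕ) (z i') (Icc a b) t :=
    ae_all_iff.2 fun i' => ae_all_iff.2 fun k => h i' k (by omega)
  filter_upwards [hall] with t ht
  simp only [component, SobolevSpace.coe_mk, SobolevSpace.coe_add, L_apply, Pi.add_apply]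
  have hr := ht i (Fin.last r)
  rw [Fin.val_last] at hr
  rw [hr]
  simp only [lowerOrder, Finset.sum_apply, Pi.mul_apply, Pi.add_apply, SobolevSpace.coe_add]
  have h1 : ∀ (j : Fin r) (i' : Fin m), P.A j t i i' *
      iteratedDerivWithin (j : ℕ) ((y i' : ℝ → ℂ) + (z i' : ℝ → ℂ)) (Icc a b) t =
      P.A j t i i' * iteratedDerivWithin (j : ℕ) (y i') (Icc a b) t +
      P.A j t i i' * iteratedDerivWithin (j : ℕ) (z i') (Icc a b) t := fun j i' => by
    rw [← mul_add]
    exact congrArg _ (ht i' j.castSucc)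
  simp only [h1, Finset.sum_add_distrib]
  ring

theorem component_smul (P : BoundaryProblem hab p n m r l) (c : ℂ)
    (y : Fin m → SobolevSpace hab p (n + r)) (i : Fin m) :
    P.component (c • y) i = c • P.component y i := by
  refine Subtype.ext (funext fun t => ?_)
  change P.component (c • y) i t = c • P.component y i t
  simp only [component, SobolevSpace.coe_mk, L_apply, lowerOrder, Pi.add_apply, Finset.sum_apply,
    Pi.mul_apply, Pi.smul_apply, SobolevSpace.coe_smul, iteratedDerivWithin_const_smul_field,
    smul_add, Finset.smul_sum, mul_smul_comm]

theorem exists_enorm_component_le (P : BoundaryProblem hab p n m r l) :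
    ∃ C : ℝ≥0, ∀ y i, ‖P.component y i‖ₑ ≤ C * ‖y‖ₑ := by
  obtain ⟨C, hC⟩ := exists_sobolevNorm_lowerOrder_le hab p n m r
  set S : ℝ≥0∞ := ∑ i, ∑ j, ∑ i', sobolevNorm a b p n (fun t => P.A j t i i') with hS
  have hSt : S ≠ ∞ := by
    simp only [hS, ne_eq, ENNReal.sum_eq_top, not_exists, not_and]
    exact fun i _ j _ i' _ => ((P.A_mem j i i').sobolevNorm_lt_top hab).ne
  refine ⟨(1 + C * S).toNNReal, fun y i => ?_⟩
  rw [ENNReal.coe_toNNReal (by finiteness), SobolevSpace.enorm_def, component,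
    SobolevSpace.coe_mk, L_apply, add_mul, one_mul]
  refine (sobolevNorm_add_le hab Fact.out ((y i).memSobolev.memSobolev_iteratedDerivWithin hab)
    (hC P.A P.A_mem y i).1).trans (add_le_add ?_ ?_)
  · refine sobolevNorm_iteratedDerivWithin_le.trans ?_
    rw [← SobolevSpace.enorm_def]
    exact ENNReal.coe_le_coe.2 (nnnorm_le_pi_nnnorm y i)
  · refine (hC P.A P.A_mem y i).2.trans ?_
    gcongr
    exact Finset.single_le_sum (f := fun i => ∑ j, ∑ i', sobolevNorm a b p n (fun t => P.A j t i i'))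
      (fun _ _ => zero_le) (Finset.mem_univ i)

/-- The differential operator `L : (W_p^{n+r})^m → (W_p^n)^m`. For `n = 0` it is additive only up to
null sets, so its values are taken in the quotient by the null functions. -/
noncomputable def operator (P : BoundaryProblem hab p n m r l) :
    (Fin m → SobolevSpace hab p (n + r)) →L[ℂ]
      (Fin m → SeparationQuotient (SobolevSpace hab p n)) :=
  LinearMap.mkContinuousOfExistsBound
    { toFun := fun y i => SeparationQuotient.mk (P.component y i)
      map_add' := fun y z => funext fun i =>
        SeparationQuotient.mk_eq_mk.2 (P.component_add_inseparable y z i)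
      map_smul' := fun c y => funext fun i => by
        rw [component_smul]
        rfl }
    (by
      obtain ⟨C, hC⟩ := P.exists_enorm_component_le
      refine ⟨C, fun y => (pi_norm_le_iff_of_nonneg (by positivity)).2 fun i => ?_⟩
      change ‖SeparationQuotient.mk (P.component y i)‖ ≤ _
      rw [SeparationQuotient.norm_mk]
      exact norm_le_mul_norm_of_enorm_le (hC y i))

theorem operator_apply (P : BoundaryProblem hab p n m r l)
    (y : Fin m → SobolevSpace hab p (n + r)) (i : Fin m) :
    P.operator y i = SeparationQuotient.mk (P.component y i) := rfl

/-- The boundary operator `B`, as a bounded operator. -/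
noncomputable def boundary (P : BoundaryProblem hab p n m r l) :
    (Fin m → SobolevSpace hab p (n + r)) →L[ℂ] (Fin l → ℂ) :=
  LinearMap.mkContinuousOfExistsBound
    { toFun := fun y => P.B y
      map_add' := fun y z => P.B.map_add y z
      map_smul' := fun c y => P.B.map_smul c y }
    (by
      obtain ⟨C, hC⟩ := P.B_bounded
      refine ⟨(C * m : ℝ≥0), fun y => ?_⟩
      have h : ‖P.B y‖ₑ ≤ C * (m * ‖y‖ₑ) := by
        refine (hC y).trans ?_
        gcongr
        have hi : ∀ i ∈ Finset.univ, sobolevNorm a b p (n + r) (y i) ≤ ‖y‖ₑ := fun i _ => by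
          rw [← SobolevSpace.enorm_def]
          exact ENNReal.coe_le_coe.2 (nnnorm_le_pi_nnnorm y i)
        exact (Finset.sum_le_card_nsmul Finset.univ _ _ hi).trans_eq (by simp)
      rw [← mul_assoc] at h
      exact norm_le_mul_norm_of_enorm_le (C := C * m) (by exact_mod_cast h))

/-! ### Solvability as surjectivity -/

/-- For `n ≥ 1` both sides of the differential equation are continuous, so that equality on `(a,b)`
and equality almost everywhere are the same. -/
theorem isSolution_iff (P : BoundaryProblem hab p n m r l) {f : ℝ → Fin m → ℂ}
    (hf : ∀ i, MemSobolev a b p n (fun t => f t i)) {c : Fin l → ℂ}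
    (y : Fin m → SobolevSpace hab p (n + r)) :
    P.IsSolution f c y ↔
      (∀ i, (fun t => P.L y t i) =ᵐ[volume.restrict (Icc a b)] fun t => f t i) ∧ P.B y = c := by
  constructor
  · rintro ⟨h0, h1, hc⟩
    refine ⟨fun i => ?_, hc⟩
    have h : ∀ᵐ t ∂(volume.restrict (Ioo a b)), P.L y t = f t := by
      rcases Nat.eq_zero_or_pos n with hn | hn
      · exact h0 hn
      · exact (ae_restrict_iff' measurableSet_Ioo).2 (.of_forall (h1 hn))
    rw [Measure.restrict_congr_set Ioo_ae_eq_Icc] at h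
    filter_upwards [h] with t ht
    rw [ht]
  · rintro ⟨h, hc⟩
    refine ⟨fun _ => ?_, fun hn t ht => ?_, hc⟩
    · rw [Measure.restrict_congr_set Ioo_ae_eq_Icc]
      filter_upwards [ae_all_iff.2 h] with t ht
      exact funext ht
    · exact funext fun i =>
        (P.memSobolev_L y i).eqOn_of_ae_eq hab hn (hf i) (h i) (Ioo_subset_Icc_self ht)

theorem solvable_iff_surjective (P : BoundaryProblem hab p n m r l) :
    P.Solvable ↔ Function.Surjective fun y => (P.operator y, P.boundary y) := by
  constructor
  · rintro hP ⟨F, c⟩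
    choose g hg using fun i => SeparationQuotient.surjective_mk (F i)
    obtain ⟨y, hy⟩ : ∃ y : Fin m → SobolevSpace hab p (n + r),
        P.IsSolution (fun t i => g i t) c y := hP _ (fun i => (g i).memSobolev) c
    obtain ⟨h1, h2⟩ := (P.isSolution_iff (fun i => (g i).memSobolev) y).1 hy
    refine ⟨y, Prod.ext (funext fun i => ?_) h2⟩
    change P.operator y i = F i
    rw [operator_apply, ← hg, SeparationQuotient.mk_eq_mk, SobolevSpace.inseparable_iff_ae_eq]
    exact h1 i
  · intro hP f hf c
    obtain ⟨y, hy⟩ := hP (fun i => SeparationQuotient.mk (SobolevSpace.mk _ (hf i)), c)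
    refine ⟨y, (P.isSolution_iff hf y).2 ⟨fun i => ?_, congrArg Prod.snd hy⟩⟩
    exact SobolevSpace.inseparable_iff_ae_eq.1
      (SeparationQuotient.mk_eq_mk.1 (congrFun (congrArg Prod.fst hy) i))

/-! ### Strong convergence implies convergence of the coefficients -/

/-- Testing strong convergence on the vector functions `t^j e_{i'}` gives the convergence of the
coefficients in `W_p^n`, by induction on `j`: the coefficients of order above `j` do not contribute,
and those of order below `j` are already known to converge. -/
theorem StronglyConverges.tendsto_coeff {P : ℕ → BoundaryProblem hab p n m r l}
    {Q : BoundaryProblem hab p n m r l} (hPQ : StronglyConverges P Q) (j : Fin r) (i i' : Fin m) :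
    Tendsto (fun k => sobolevNorm a b p n (fun t => ((P k).A j t - Q.A j t) i i')) atTop (𝓝 0) := by
  induction j using WellFoundedLT.induction with
  | ind j ih =>
  obtain ⟨C, hC⟩ := exists_sobolevNorm_mul_le (p := p) hab Fact.out n
  have hmono : ∀ s, MemSobolev a b p s (fun t : ℝ => (t : ℂ) ^ (j : ℕ)) := fun s =>
    .of_contDiffOn hab (contDiff_ofReal_pow _).contDiffOn
  set y : Fin m → SobolevSpace hab p (n + r) :=
    Pi.single i' (SobolevSpace.mk _ (hmono (n + r))) with hy
  set D : ℕ → Fin r → ℝ → ℂ := fun k q t => ((P k).A q t - Q.A q t) i i' with hD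
  set E : Fin r → ℝ → ℂ := fun q =>
    iteratedDerivWithin (q : ℕ) (fun t : ℝ => (t : ℂ) ^ (j : ℕ)) (Icc a b) with hE
  have hDm : ∀ k q, MemSobolev a b p n (D k q) := fun k q =>
    (SobolevSpace.mk (hab := hab) _ ((P k).A_mem q i i') -
      SobolevSpace.mk (hab := hab) _ (Q.A_mem q i i')).memSobolev
  have hEm : ∀ q, MemSobolev a b p (n + 1) (E q) := fun q =>
    (hmono (n + 1 + q)).memSobolev_iteratedDerivWithin hab
  set F : ℕ → ℝ → ℂ := fun k t => (P k).L y t i - Q.L y t i with hF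
  have hFm : ∀ k, MemSobolev a b p n (F k) := fun k =>
    ((P k).component y i - Q.component y i).memSobolev
  have hFsum : ∀ k, F k = ∑ q, D k q * E q := fun k => by
    rw [hF]
    simp only
    rw [L_sub_L, lowerOrder]
    refine Finset.sum_congr rfl fun q _ => ?_
    rw [Finset.sum_eq_single i']
    · simp only [hy, Pi.single_eq_same, SobolevSpace.coe_mk, hD, hE]
    · intro i'' _ hne
      have h0 : ((y i'' : SobolevSpace hab p (n + r)) : ℝ → ℂ) = 0 := by
        rw [hy, Pi.single_eq_of_ne hne]
        rfl
      rw [h0]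
      funext t
      simp
    · simp
  -- Isolate the coefficient of order `j`: `t^j` has `j`-th derivative `j!`, and zero derivatives of
  -- higher order.
  have hid : ∀ k, EqOn (((j : ℕ).factorial : ℂ) • D k j)
      (F k + ∑ q ∈ Finset.univ.filter (· < j), (-1 : ℂ) • (D k q * E q)) (Icc a b) := by
    intro k t ht
    have h1 : ∑ q, D k q t * E q t = D k j t * ((j : ℕ).factorial : ℂ) +
        ∑ q ∈ Finset.univ.filter (· < j), D k q t * E q t := by
      have hj : E j t = ((j : ℕ).factorial : ℂ) := by
        simp [hE, iteratedDerivWithin_ofReal_pow hab _ _ ht, Nat.descFactorial_self]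
      rw [← hj, ← Finset.sum_insert (s := Finset.univ.filter (· < j)) (a := j)
        (f := fun q => D k q t * E q t) (by simp)]
      refine (Finset.sum_subset (Finset.subset_univ _) fun q _ hq => ?_).symm
      have hq' : j < q := by
        simp only [Finset.mem_insert, Finset.mem_filter, Finset.mem_univ, true_and, not_or,
          not_lt] at hq
        exact lt_of_le_of_ne hq.2 (Ne.symm hq.1)
      simp [hE, iteratedDerivWithin_ofReal_pow hab _ _ ht, Nat.descFactorial_of_lt hq']
    have h2 : F k t = ∑ q, D k q t * E q t := by
      rw [hFsum k]
      simp only [Finset.sum_apply, Pi.mul_apply]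
    simp only [Pi.smul_apply, Pi.add_apply, Finset.sum_apply, Pi.mul_apply, smul_eq_mul, h2, h1,
      neg_mul, one_mul, Finset.sum_neg_distrib]
    ring
  have hbound : ∀ k, sobolevNorm a b p n (D k j) ≤ sobolevNorm a b p n (F k) +
      ∑ q ∈ Finset.univ.filter (· < j),
        C * (sobolevNorm a b p n (D k q) * sobolevNorm a b p (n + 1) (E q)) := by
    intro k
    have hm : ∀ q ∈ Finset.univ.filter (· < j), MemSobolev a b p n ((-1 : ℂ) • (D k q * E q)) :=
      fun q _ => (hC _ _ (hDm k q) (hEm q)).1.smul _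
    calc sobolevNorm a b p n (D k j)
        ≤ ‖((j : ℕ).factorial : ℂ)‖ₑ * sobolevNorm a b p n (D k j) := by
          refine le_mul_of_one_le_left zero_le ?_
          rw [← ofReal_norm, Complex.norm_natCast, ENNReal.one_le_ofReal]
          exact_mod_cast Nat.one_le_iff_ne_zero.2 (Nat.factorial_ne_zero _)
      _ = sobolevNorm a b p n
            (F k + ∑ q ∈ Finset.univ.filter (· < j), (-1 : ℂ) • (D k q * E q)) := by
          rw [← sobolevNorm_smul, sobolevNorm_congr (hid k)]
      _ ≤ _ := by
          refine (sobolevNorm_add_le hab Fact.out (hFm k) (MemSobolev.sum hab hm)).trans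
            (add_le_add le_rfl ((sobolevNorm_sum_le hab Fact.out hm).trans
              (Finset.sum_le_sum fun q _ => ?_)))
          rw [sobolevNorm_smul, enorm_neg, enorm_one, one_mul]
          exact (hC _ _ (hDm k q) (hEm q)).2
  have hFlim : Tendsto (fun k => sobolevNorm a b p n (F k)) atTop (𝓝 0) :=
    tendsto_of_tendsto_of_tendsto_of_le_of_le tendsto_const_nhds (hPQ y).1 (fun _ => zero_le)
      fun k => Finset.single_le_sum
        (f := fun i => sobolevNorm a b p n (fun t => (P k).L y t i - Q.L y t i))
        (fun _ _ => zero_le) (Finset.mem_univ i)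
  have hsum : Tendsto (fun k => ∑ q ∈ Finset.univ.filter (· < j),
      C * (sobolevNorm a b p n (D k q) * sobolevNorm a b p (n + 1) (E q))) atTop (𝓝 0) := by
    rw [← Finset.sum_const_zero (s := Finset.univ.filter (· < j))]
    refine tendsto_finsetSum _ fun q hq => ?_
    have h := ENNReal.Tendsto.const_mul (a := (C : ℝ≥0∞)) (ENNReal.Tendsto.mul_const
      (b := sobolevNorm a b p (n + 1) (E q)) (ih q (Finset.mem_filter.1 hq).2)
      (.inr ((hEm q).sobolevNorm_lt_top hab).ne)) (.inr ENNReal.coe_ne_top)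
    simpa only [mul_zero, zero_mul] using h
  have hlim := hFlim.add hsum
  rw [add_zero] at hlim
  exact tendsto_of_tendsto_of_tendsto_of_le_of_le tendsto_const_nhds hlim (fun _ => zero_le) hbound

theorem StronglyConverges.tendsto_operator {P : ℕ → BoundaryProblem hab p n m r l}
    {Q : BoundaryProblem hab p n m r l} (hPQ : StronglyConverges P Q) :
    Tendsto (fun k => (P k).operator) atTop (𝓝 Q.operator) := by
  obtain ⟨C, hC⟩ := exists_sobolevNorm_lowerOrder_le hab p n m r
  set S : ℕ → ℝ≥0∞ := fun k =>
    ∑ i, ∑ j, ∑ i', sobolevNorm a b p n (fun t => ((P k).A j t - Q.A j t) i i') with hS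
  have hA : ∀ k j i i', MemSobolev a b p n (fun t => ((P k).A j t - Q.A j t) i i') :=
    fun k j i i' => (SobolevSpace.mk (hab := hab) _ ((P k).A_mem j i i') -
      SobolevSpace.mk (hab := hab) _ (Q.A_mem j i i')).memSobolev
  have hSt : ∀ k, S k ≠ ∞ := fun k => by
    simp only [hS, ne_eq, ENNReal.sum_eq_top, not_exists, not_and]
    exact fun i _ j _ i' _ => ((hA k j i i').sobolevNorm_lt_top hab).ne
  have hS0 : Tendsto S atTop (𝓝 0) := by
    have : (0 : ℝ≥0∞) = ∑ _i : Fin m, ∑ _j : Fin r, ∑ _i' : Fin m, 0 := by simp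
    rw [this]
    exact tendsto_finsetSum _ fun i _ => tendsto_finsetSum _ fun j _ =>
      tendsto_finsetSum _ fun i' _ => hPQ.tendsto_coeff j i i'
  rw [tendsto_iff_norm_sub_tendsto_zero]
  have hlim : Tendsto (fun k => (C : ℝ) * (S k).toReal) atTop (𝓝 0) := by
    simpa using ((ENNReal.tendsto_toReal ENNReal.zero_ne_top).comp hS0).const_mul (C : ℝ)
  refine squeeze_zero (fun _ => norm_nonneg _) (fun k => ?_) hlim
  refine ContinuousLinearMap.opNorm_le_bound _ (by positivity) fun y => ?_
  refine (pi_norm_le_iff_of_nonneg (by positivity)).2 fun i => ?_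
  change ‖SeparationQuotient.mk ((P k).component y i) - SeparationQuotient.mk (Q.component y i)‖ ≤ _
  rw [← SeparationQuotient.mk_sub, SeparationQuotient.norm_mk, SobolevSpace.norm_def,
    ← toReal_enorm y, ← ENNReal.coe_toReal C, ← ENNReal.toReal_mul, ← ENNReal.toReal_mul]
  refine ENNReal.toReal_mono (ENNReal.mul_ne_top (ENNReal.mul_ne_top ENNReal.coe_ne_top (hSt k))
    enorm_ne_top) ?_
  change sobolevNorm a b p n (fun t => (P k).L y t i - Q.L y t i) ≤ _
  rw [L_sub_L]
  refine (hC _ (hA k) y i).2.trans ?_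
  gcongr
  exact Finset.single_le_sum (f := fun i => ∑ j, ∑ i', sobolevNorm a b p n
    (fun t => ((P k).A j t - Q.A j t) i i')) (fun _ _ => zero_le) (Finset.mem_univ i)

end BoundaryProblem

end GenericBVP

theorem corollary3 {a b : ℝ} (hab : a < b) (p : ℝ≥0∞) (hp : 1 ≤ p) (n m r l : ℕ)
    (hm : 0 < m) (hr : 0 < r) (hl : 0 < l)
    (P : ℕ → GenericBVP.BoundaryProblem hab p n m r l)
    (Q : GenericBVP.BoundaryProblem hab p n m r l)
    (hPQ : GenericBVP.BoundaryProblem.StronglyConverges P Q)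
    (hQ : Q.Solvable) :
    ∀ᶠ k in atTop, (P k).Solvable := by
  have : Fact (1 ≤ p) := ⟨hp⟩
  simp only [GenericBVP.BoundaryProblem.solvable_iff_surjective] at hQ ⊢
  exact ContinuousLinearMap.eventually_surjective_prod hPQ.tendsto_operator
    (B := fun k => (P k).boundary) (B₀ := Q.boundary) (fun y => (hPQ y).2) hQ
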